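/- Let $(\Omega,\Sigma,\mu)$ be a complete finite measure space, and let $L^0(\Omega)$ be the algebra of classes, modulo a.e. equality, of complex measurable functions on $\Omega$. Let $(\mathcal H,L)$ be a measurable bundle of complex Hilbert spaces over $\Omega$: each $\omega\in\Omega$ is assigned a Hilbert space $\mathcal H(\omega)$, and $L$ is a set of a.e. defined sections $c$ ($c(\omega)\in\mathcal H(\omega)$ for $\omega\in\operatorname{dom}c$) that is closed under linear combinations (taken on the intersection of the domains), such that $\omega\mapsto\|c(\omega)\|$ is measurable on $\operatorname{dom} c$ for every $c\in L$, and $\{c(\omega):c\in L,\ \omega\in\operatorname{dom}c\}$ is dense in $\mathcal H(\omega)$ for every $\omega\in\Omega$. A section is measurable if it is an a.e. limit of a sequence of step-sections $\sum_{i=1}^m\chi_{A_i}c_i$ ($A_i\in\Sigma$, $c_i\in L$); $L^0(\Omega,\mathcal H)$ is the $L^0(\Omega)$-module of measurable sections modulo a.e. equality, with the $L^0(\Omega)$-valued norm $\|\hat u\|=[\omega\mapsto\|u(\omega)\|]$ and inner product $\langle\hat u,\hat v\rangle=[\omega\mapsto(u(\omega),v(\omega))]$. A net $(x_\alpha)$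 in $L^0(\Omega,\mathcal H)$ converges in norm to $x$ if there is a decreasing net $(e_\gamma)$ in $L^0(\Omega)$ with infimum $0$ such that for every $\gamma$ there is $\alpha(\gamma)$ with $\|x-x_\alpha\|\le e_\gamma$ for all $\alpha\ge\alpha(\gamma)$. A contraction in $L^0(\Omega,\mathcal H)$ is an $L^0(\Omega)$-linear operator $T$ on $L^0(\Omega,\mathcal H)$ that maps norm-bounded sets to norm-bounded sets and satisfies $\|T\|=\sup\{\|T\hat u\|:\|\hat u\|\le\mathbf 1\}\le\mathbf 1$ in $L^0(\Omega)$. A projection is an $L^0(\Omega)$-linear operator $P$ with $P^2=P$ and $\langle P\hat u,\hat v\rangle=\langle\hat u,P\hat v\rangle$ for all $\hat u,\hat v$. **Theorem 3.4 (multiparameter mean ergodic theorem).** Let $T_1,\dots,T_d$ be (not necessarily commuting) contractions in $L^0(\Omega,\mathcal H)$. Then for every $\hat u\in L^0(\Omega,\mathcal H)$ the averages $$A_{n_1,\dots,n_d}(T_1,\dots,T_d,\hat u)=\frac1{n_1\cdots n_d}\sum_{i_1=0}^{n_1-1}\cdots\sum_{i_d=0}^{n_d-1}T_1^{i_1}\cdots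 T_d^{i_d}\hat u$$ converge in norm as $n_1,\dots,n_d\to\infty$ independently (that is, as a net indexed by $(n_1,\dots,n_d)\in\mathbb N^d$ with the product order). More precisely, there are projections $P_1,\dots,P_d$ in $L^0(\Omega,\mathcal H)$ such that $\frac1n\sum_{k=0}^{n-1}T_j^k\hat u\to P_j\hat u$ in norm as $n\to\infty$ for every $j$ and every $\hat u$, and $A_{n_1,\dots,n_d}(T_1,\dots,T_d,\hat u)\to P_1P_2\cdots P_d\hat u$ in norm for every $\hat u$. -/

import Mathlib

open MeasureTheory Filter Topology

namespace HilbertKaplansky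

universe u v

/-- The algebra structure of `L⁰(Ω)`, extending Mathlib's additive and multiplicative ones. -/
noncomputable instance {Ω : Type u} [MeasurableSpace Ω] {μ : Measure Ω} :
    CommRing (Ω →ₘ[μ] ℂ) :=
  { AEEqFun.instAddCommGroup, AEEqFun.instCommMonoid with
    left_distrib := fun a b c => AEEqFun.toGerm_injective <| by
      simp only [AEEqFun.mul_toGerm, AEEqFun.add_toGerm, mul_add]
    right_distrib := fun a b c => AEEqFun.toGerm_injective <| by
      simp only [AEEqFun.mul_toGerm, AEEqFun.add_toGerm, add_mul]
    zero_mul := fun a => AEEqFun.toGerm_injective <| by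
      simp only [AEEqFun.mul_toGerm, AEEqFun.zero_toGerm, zero_mul]
    mul_zero := fun a => AEEqFun.toGerm_injective <| by
      simp only [AEEqFun.mul_toGerm, AEEqFun.zero_toGerm, mul_zero] }

section Sections

variable {Ω : Type u} [MeasurableSpace Ω]

/-- A section of `H`: a function `ω ↦ c ω ∈ H ω` defined for almost every `ω`. -/
structure AESection (μ : Measure Ω) (H : Ω → Type v) where
  dom : Set Ω
  ae_mem_dom : ∀ᵐ ω ∂μ, ω ∈ dom
  val : ∀ ω : dom, H ω

variable {μ : Measure Ω} {H : Ω → Type v}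
variable [∀ ω, NormedAddCommGroup (H ω)] [∀ ω, InnerProductSpace ℂ (H ω)]

/-- `a • c₁ + b • c₂`, defined on the intersection of the two domains. -/
def AESection.lincomb (a b : ℂ) (c₁ c₂ : AESection μ H) : AESection μ H where
  dom := c₁.dom ∩ c₂.dom
  ae_mem_dom := by
    filter_upwards [c₁.ae_mem_dom, c₂.ae_mem_dom] with ω h₁ h₂ using ⟨h₁, h₂⟩
  val ω := a • c₁.val ⟨ω, ω.2.1⟩ + b • c₂.val ⟨ω, ω.2.2⟩

open Classical in
/-- The everywhere defined section that agrees with `c` on its domain and is `0` elsewhere. -/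
noncomputable def AESection.extend (c : AESection μ H) (ω : Ω) : H ω :=
  if h : ω ∈ c.dom then c.val ⟨ω, h⟩ else 0

theorem AESection.extend_lincomb (a b : ℂ) (c₁ c₂ : AESection μ H) :
    ∀ᵐ ω ∂μ, (AESection.lincomb a b c₁ c₂).extend ω = a • c₁.extend ω + b • c₂.extend ω := by
  filter_upwards [c₁.ae_mem_dom, c₂.ae_mem_dom] with ω h₁ h₂
  have h : ω ∈ (AESection.lincomb a b c₁ c₂).dom := ⟨h₁, h₂⟩
  simp only [AESection.extend, dif_pos h, dif_pos h₁, dif_pos h₂]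
  rfl

end Sections

/-- A measurable bundle of Hilbert spaces over `(Ω, μ)` with fibres `H ω`. -/
structure MeasurableBundle {Ω : Type u} [MeasurableSpace Ω] (μ : Measure Ω) (H : Ω → Type v)
    [∀ ω, NormedAddCommGroup (H ω)] [∀ ω, InnerProductSpace ℂ (H ω)] where
  sections : Set (AESection μ H)
  lincomb_mem : ∀ (a b : ℂ), ∀ c₁ ∈ sections, ∀ c₂ ∈ sections,
    AESection.lincomb a b c₁ c₂ ∈ sections
  measurable_norm : ∀ c ∈ sections, Measurable fun ω : c.dom => ‖c.val ω‖
  dense_values : ∀ ω, Dense {x : H ω | ∃ c ∈ sections, ∃ h : ω ∈ c.dom, c.val ⟨ω, h⟩ = x}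

namespace MeasurableBundle

variable {Ω : Type u} [MeasurableSpace Ω] {μ : Measure Ω} {H : Ω → Type v}
variable [∀ ω, NormedAddCommGroup (H ω)] [∀ ω, InnerProductSpace ℂ (H ω)]
variable (B : MeasurableBundle μ H)

/-- Step-sections `∑ i, χ_{A i} c i` with `A i` measurable and `c i` in the given set of sections
(the value at a point outside the domain of `c i`, a null set, is irrelevant). -/
def IsStepSection (s : ∀ ω, H ω) : Prop :=
  ∃ (n : ℕ) (A : Fin n → Set Ω) (c : Fin n → AESection μ H),
    (∀ i, MeasurableSet (A i)) ∧ (∀ i, c i ∈ B.sections) ∧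
    ∀ ω, s ω = ∑ i, (A i).indicator (fun _ => (1 : ℂ)) ω • (c i).extend ω

/-- Measurable sections: almost everywhere limits of sequences of step-sections.  As only classes
modulo a.e. equality matter, everywhere defined representatives are used. -/
def IsMeasurableSection (u : ∀ ω, H ω) : Prop :=
  ∃ s : ℕ → ∀ ω, H ω, (∀ n, B.IsStepSection (s n)) ∧
    ∀ᵐ ω ∂μ, Tendsto (fun n => ‖s n ω - u ω‖) atTop (𝓝 0)

variable {B}

theorem IsStepSection.zero : B.IsStepSection 0 :=
  ⟨0, Fin.elim0, Fin.elim0, fun i => i.elim0, fun i => i.elim0, fun ω => by simp⟩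

theorem IsStepSection.add {s t : ∀ ω, H ω} (hs : B.IsStepSection s) (ht : B.IsStepSection t) :
    B.IsStepSection (s + t) := by
  obtain ⟨n, A, c, hA, hc, h⟩ := hs
  obtain ⟨m, A', c', hA', hc', h'⟩ := ht
  refine ⟨n + m, Fin.append A A', Fin.append c c', ?_, ?_, ?_⟩
  · intro i
    refine Fin.addCases (fun i => ?_) (fun i => ?_) i
    · simpa using hA i
    · simpa using hA' i
  · intro i
    refine Fin.addCases (fun i => ?_) (fun i => ?_) i
    · simpa using hc i
    · simpa using hc' i
  · intro ω
    simp [Fin.sum_univ_add, h ω, h' ω]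

theorem IsStepSection.sum {ι : Type*} (S : Finset ι) {s : ι → ∀ ω, H ω}
    (hs : ∀ i ∈ S, B.IsStepSection (s i)) : B.IsStepSection (∑ i ∈ S, s i) :=
  Finset.sum_induction _ _ (fun _ _ => IsStepSection.add) IsStepSection.zero hs

/-- The product of a step-section and `a χ_E` is, up to a null set, a step-section. -/
theorem IsStepSection.indicator_smul {s : ∀ ω, H ω} (hs : B.IsStepSection s) (a : ℂ) {E : Set Ω}
    (hE : MeasurableSet E) : ∃ t, B.IsStepSection t ∧
      ∀ᵐ ω ∂μ, t ω = E.indicator (fun _ => a) ω • s ω := by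
  obtain ⟨n, A, c, hA, hc, h⟩ := hs
  refine ⟨_, ⟨n, fun i => E ∩ A i, fun i => AESection.lincomb a 0 (c i) (c i),
    fun i => hE.inter (hA i), fun i => B.lincomb_mem _ _ _ (hc i) _ (hc i), fun ω => rfl⟩, ?_⟩
  have hall : ∀ᵐ ω ∂μ, ∀ i, (AESection.lincomb a 0 (c i) (c i)).extend ω = a • (c i).extend ω := by
    rw [ae_all_iff]
    intro i
    filter_upwards [AESection.extend_lincomb a 0 (c i) (c i)] with ω hω
    simpa using hω
  filter_upwards [hall] with ω hω
  rw [h ω, Finset.smul_sum]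
  refine Finset.sum_congr rfl fun i _ => ?_
  rw [hω i]
  by_cases h1 : ω ∈ E <;> by_cases h2 : ω ∈ A i <;> simp [h1, h2]

theorem IsStepSection.simpleFunc_smul {s : ∀ ω, H ω} (hs : B.IsStepSection s)
    (f : SimpleFunc Ω ℂ) : ∃ t, B.IsStepSection t ∧ ∀ᵐ ω ∂μ, t ω = f ω • s ω := by
  choose t ht hts using fun a : ℂ =>
    hs.indicator_smul a (f.measurableSet_fiber a)
  refine ⟨∑ a ∈ f.range, t a, IsStepSection.sum _ fun a _ => ht a, ?_⟩
  have hall : ∀ᵐ ω ∂μ, ∀ a ∈ f.range, t a ω = (f ⁻¹' {a}).indicator (fun _ => a) ω • s ω :=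
    (ae_ball_iff f.range.countable_toSet).2 fun a _ => hts a
  filter_upwards [hall] with ω hω
  rw [Finset.sum_apply, Finset.sum_congr rfl hω, ← Finset.sum_smul]
  congr 1
  rw [Finset.sum_eq_single (f ω)]
  · simp
  · intro b _ hb
    simp [Set.indicator, Ne.symm hb]
  · intro hn
    exact absurd (f.mem_range_self ω) hn

theorem IsMeasurableSection.zero : B.IsMeasurableSection 0 :=
  ⟨fun _ => 0, fun _ => IsStepSection.zero, by simp⟩

theorem IsMeasurableSection.add {u w : ∀ ω, H ω} (hu : B.IsMeasurableSection u)
    (hw : B.IsMeasurableSection w) : B.IsMeasurableSection (u + w) := by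
  obtain ⟨s, hs, hsu⟩ := hu
  obtain ⟨t, ht, htw⟩ := hw
  refine ⟨fun n => s n + t n, fun n => (hs n).add (ht n), ?_⟩
  filter_upwards [hsu, htw] with ω h₁ h₂
  rw [← tendsto_iff_norm_sub_tendsto_zero] at *
  exact h₁.add h₂

theorem IsMeasurableSection.smul {u : ∀ ω, H ω} (hu : B.IsMeasurableSection u) {f : Ω → ℂ}
    (hf : StronglyMeasurable f) : B.IsMeasurableSection (fun ω => f ω • u ω) := by
  obtain ⟨s, hs, hsu⟩ := hu
  choose t ht hts using fun n => (hs n).simpleFunc_smul (hf.approx n)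
  refine ⟨t, ht, ?_⟩
  filter_upwards [hsu, ae_all_iff.2 hts] with ω h₁ h₂
  rw [← tendsto_iff_norm_sub_tendsto_zero] at *
  simp only [h₂]
  exact (hf.tendsto_approx ω).smul h₁

section Measurability

theorem aestronglyMeasurable_norm_extend [μ.IsComplete] {c : AESection μ H}
    (hc : c ∈ B.sections) : AEStronglyMeasurable (fun ω => ‖c.extend ω‖) μ := by
  classical
  have hd : MeasurableSet c.dom :=
    (Measure.IsComplete.out' _ c.ae_mem_dom).of_compl
  refine Measurable.aestronglyMeasurable ?_
  have : (fun ω => ‖c.extend ω‖) =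
      fun ω => if h : ω ∈ c.dom then ‖c.val ⟨ω, h⟩‖ else (0 : ℝ) := by
    funext ω
    by_cases h : ω ∈ c.dom <;> simp [AESection.extend, h]
  rw [this]
  exact Measurable.dite (s := c.dom) (B.measurable_norm c hc) measurable_const hd

theorem aestronglyMeasurable_inner_extend [μ.IsComplete] {c d : AESection μ H}
    (hc : c ∈ B.sections) (hd : d ∈ B.sections) :
    AEStronglyMeasurable (fun ω => inner ℂ (c.extend ω) (d.extend ω)) μ := by
  have key : ∀ a : ℂ, AEStronglyMeasurable (fun ω => (‖c.extend ω + a • d.extend ω‖ : ℂ)) μ := by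
    intro a
    refine Complex.continuous_ofReal.comp_aestronglyMeasurable
      ((aestronglyMeasurable_norm_extend (B.lincomb_mem 1 a c hc d hd)).congr ?_)
    filter_upwards [AESection.extend_lincomb 1 a c d] with ω hω
    rw [hω, one_smul]
  have h := (((key 1).pow 2).sub ((key (-1)).pow 2)).add
    ((((key (-Complex.I)).pow 2).sub ((key Complex.I).pow 2)).mul_const Complex.I)
  refine (h.mul_const (4⁻¹ : ℂ)).congr (Eventually.of_forall fun ω => ?_)
  simp only [inner_eq_sum_norm_sq_div_four (𝕜 := ℂ) (c.extend ω) (d.extend ω)]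
  simp [sub_eq_add_neg, div_eq_mul_inv]

theorem IsStepSection.aestronglyMeasurable_inner [μ.IsComplete] {s t : ∀ ω, H ω}
    (hs : B.IsStepSection s) (ht : B.IsStepSection t) :
    AEStronglyMeasurable (fun ω => inner ℂ (s ω) (t ω)) μ := by
  obtain ⟨n, A, c, hA, hc, h⟩ := hs
  obtain ⟨m, A', c', hA', hc', h'⟩ := ht
  simp only [h, h', sum_inner, inner_sum, inner_smul_left, inner_smul_right,
    Finset.mul_sum]
  refine Finset.aestronglyMeasurable_fun_sum _ fun i _ =>
    Finset.aestronglyMeasurable_fun_sum _ fun j _ => ?_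
  refine AEStronglyMeasurable.mul ?_ (AEStronglyMeasurable.mul ?_
    (aestronglyMeasurable_inner_extend (hc _) (hc' _)))
  · exact (stronglyMeasurable_const.indicator (hA' _)).aestronglyMeasurable
  · exact Complex.continuous_conj.comp_aestronglyMeasurable
      (stronglyMeasurable_const.indicator (hA _)).aestronglyMeasurable

theorem IsMeasurableSection.aestronglyMeasurable_inner [μ.IsComplete] {u w : ∀ ω, H ω}
    (hu : B.IsMeasurableSection u) (hw : B.IsMeasurableSection w) :
    AEStronglyMeasurable (fun ω => inner ℂ (u ω) (w ω)) μ := by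
  obtain ⟨s, hs, hsu⟩ := hu
  obtain ⟨t, ht, htw⟩ := hw
  refine aestronglyMeasurable_of_tendsto_ae atTop
    (fun n => (hs n).aestronglyMeasurable_inner (ht n)) ?_
  filter_upwards [hsu, htw] with ω h₁ h₂
  rw [← tendsto_iff_norm_sub_tendsto_zero] at h₁ h₂
  exact h₁.inner h₂

theorem IsMeasurableSection.aestronglyMeasurable_norm [μ.IsComplete] {u : ∀ ω, H ω}
    (hu : B.IsMeasurableSection u) : AEStronglyMeasurable (fun ω => ‖u ω‖) μ := by
  have h := (Real.continuous_sqrt.comp Complex.continuous_re).comp_aestronglyMeasurable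
    (hu.aestronglyMeasurable_inner hu)
  refine h.congr (Eventually.of_forall fun ω => ?_)
  exact (norm_eq_sqrt_re_inner (𝕜 := ℂ) (u ω)).symm

end Measurability

variable (B)

/-- The space `M(Ω, H)` of measurable sections. -/
def measurableSections : Submodule ℂ (∀ ω, H ω) where
  carrier := {u | B.IsMeasurableSection u}
  zero_mem' := IsMeasurableSection.zero
  add_mem' := IsMeasurableSection.add
  smul_mem' a _ hu := hu.smul (f := fun _ => a) stronglyMeasurable_const

/-- The measurable sections that vanish almost everywhere. -/
def nullSections : Submodule ℂ B.measurableSections where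
  carrier := {u | ∀ᵐ ω ∂μ, u.1 ω = 0}
  zero_mem' := by
    change ∀ᵐ ω ∂μ, (0 : H ω) = 0
    simp
  add_mem' {u w} hu hw := by
    change ∀ᵐ ω ∂μ, u.1 ω + w.1 ω = 0
    change ∀ᵐ ω ∂μ, u.1 ω = 0 at hu
    change ∀ᵐ ω ∂μ, w.1 ω = 0 at hw
    filter_upwards [hu, hw] with ω h₁ h₂
    rw [h₁, h₂, add_zero]
  smul_mem' a u hu := by
    change ∀ᵐ ω ∂μ, a • u.1 ω = 0
    change ∀ᵐ ω ∂μ, u.1 ω = 0 at hu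
    filter_upwards [hu] with ω h
    rw [h, smul_zero]

/-- `L⁰(Ω, H)`: measurable sections modulo equality almost everywhere. -/
def L0 : Type (max u v) := B.measurableSections ⧸ B.nullSections

noncomputable instance : AddCommGroup B.L0 :=
  inferInstanceAs (AddCommGroup (B.measurableSections ⧸ B.nullSections))

noncomputable instance : Module ℂ B.L0 :=
  inferInstanceAs (Module ℂ (B.measurableSections ⧸ B.nullSections))

namespace L0

variable {B}

/-- The class of a measurable section. -/
def mk (u : B.measurableSections) : B.L0 := Submodule.Quotient.mk u

theorem mk_eq_mk {u w : B.measurableSections} : mk u = mk w ↔ ∀ᵐ ω ∂μ, u.1 ω = w.1 ω := by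
  refine (Submodule.Quotient.eq B.nullSections).trans ?_
  change (∀ᵐ ω ∂μ, u.1 ω - w.1 ω = 0) ↔ _
  simp only [sub_eq_zero]

theorem mk_surjective : Function.Surjective (mk (B := B)) := Submodule.Quotient.mk_surjective _

/-- Pointwise multiplication of measurable sections by (a representative of) `f ∈ L⁰(Ω)`. -/
noncomputable def smulAux (f : Ω →ₘ[μ] ℂ) : B.measurableSections →ₗ[ℂ] B.measurableSections where
  toFun u := ⟨fun ω => f ω • u.1 ω, IsMeasurableSection.smul u.2 f.stronglyMeasurable⟩
  map_add' u w := Subtype.ext (funext fun ω => smul_add (f ω) (u.1 ω) (w.1 ω))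
  map_smul' a u := Subtype.ext (funext fun ω => smul_comm (f ω) a (u.1 ω))

/-- `L⁰(Ω, H)` is a module over the algebra `L⁰(Ω)`, with `(f • û)(ω) = f(ω) u(ω)`. -/
noncomputable instance : SMul (Ω →ₘ[μ] ℂ) B.L0 where
  smul f := Submodule.mapQ B.nullSections B.nullSections (smulAux f) fun u hu => by
    have hu' : ∀ᵐ ω ∂μ, u.1 ω = 0 := hu
    change ∀ᵐ ω ∂μ, f ω • u.1 ω = 0
    filter_upwards [hu'] with ω h
    rw [h, smul_zero]

theorem smul_mk (f : Ω →ₘ[μ] ℂ) (u : B.measurableSections) : f • mk u = mk (smulAux f u) := rfl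

theorem mk_add (u w : B.measurableSections) : mk u + mk w = mk (u + w) := rfl

noncomputable instance : Module (Ω →ₘ[μ] ℂ) B.L0 where
  one_smul x := by
    obtain ⟨u, rfl⟩ := mk_surjective x
    rw [smul_mk, mk_eq_mk]
    filter_upwards [AEEqFun.coeFn_one (α := Ω) (β := ℂ) (μ := μ)] with ω h
    change (1 : Ω →ₘ[μ] ℂ) ω • u.1 ω = _
    rw [h, Pi.one_apply, one_smul]
  mul_smul f g x := by
    obtain ⟨u, rfl⟩ := mk_surjective x
    rw [smul_mk, smul_mk, smul_mk, mk_eq_mk]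
    filter_upwards [AEEqFun.coeFn_mul f g] with ω h
    change (f * g) ω • u.1 ω = f ω • g ω • u.1 ω
    rw [h, Pi.mul_apply, mul_smul]
  smul_zero f := map_zero (Submodule.mapQ B.nullSections B.nullSections (smulAux f) _)
  smul_add f := map_add (Submodule.mapQ B.nullSections B.nullSections (smulAux f) _)
  add_smul f g x := by
    obtain ⟨u, rfl⟩ := mk_surjective x
    rw [smul_mk, smul_mk, smul_mk, mk_add, mk_eq_mk]
    filter_upwards [AEEqFun.coeFn_add f g] with ω h
    change (f + g) ω • u.1 ω = f ω • u.1 ω + g ω • u.1 ω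
    rw [h, Pi.add_apply, add_smul]
  zero_smul x := by
    obtain ⟨u, rfl⟩ := mk_surjective x
    change _ = mk (0 : B.measurableSections)
    rw [smul_mk, mk_eq_mk]
    filter_upwards [AEEqFun.coeFn_zero (α := Ω) (β := ℂ) (μ := μ)] with ω h
    change (0 : Ω →ₘ[μ] ℂ) ω • u.1 ω = 0
    rw [h, Pi.zero_apply, zero_smul]

variable [μ.IsComplete]

/-- The `L⁰`-valued norm: the class of `ω ↦ ‖u ω‖`. -/
noncomputable def vnorm (x : B.L0) : Ω →ₘ[μ] ℝ :=
  Quotient.liftOn' x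
    (fun u => AEEqFun.mk (fun ω => ‖u.1 ω‖) (IsMeasurableSection.aestronglyMeasurable_norm u.2))
    fun u w h => by
      have h' : mk u = mk w := Quotient.sound' h
      rw [mk_eq_mk] at h'
      rw [AEEqFun.mk_eq_mk]
      filter_upwards [h'] with ω hω
      rw [hω]

theorem vnorm_mk (u : B.measurableSections) : vnorm (mk u) =
    AEEqFun.mk (fun ω => ‖u.1 ω‖) (IsMeasurableSection.aestronglyMeasurable_norm u.2) := rfl

/-- The `L⁰`-valued inner product `⟨x, y⟩`, linear in the first variable: the class of
`ω ↦ (u ω, w ω)` (Mathlib's `inner` is linear in the second variable). -/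
noncomputable def vinner (x y : B.L0) : Ω →ₘ[μ] ℂ :=
  Quotient.liftOn₂' x y
    (fun u w => AEEqFun.mk (fun ω => inner ℂ (w.1 ω) (u.1 ω))
      (IsMeasurableSection.aestronglyMeasurable_inner w.2 u.2))
    fun u w u' w' h k => by
      have h' : mk u = mk u' := Quotient.sound' h
      have k' : mk w = mk w' := Quotient.sound' k
      rw [mk_eq_mk] at h' k'
      rw [AEEqFun.mk_eq_mk]
      filter_upwards [h', k'] with ω hω kω
      rw [hω, kω]

theorem vinner_mk (u w : B.measurableSections) : vinner (mk u) (mk w) =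
    AEEqFun.mk (fun ω => inner ℂ (w.1 ω) (u.1 ω))
      (IsMeasurableSection.aestronglyMeasurable_inner w.2 u.2) := rfl

/-- `(bo)`-convergence (convergence in the `L⁰`-valued norm) of a net `x` to `x₀`: there is a
net `e` in `L⁰(Ω)` decreasing to `0` such that, for each `γ`, eventually `‖x₀ - x α‖ ≤ e γ`. -/
def BoTendsto {ι : Type*} [Preorder ι] (x : ι → B.L0) (x₀ : B.L0) : Prop :=
  ∃ (Γ : Type u) (_ : Preorder Γ) (_ : IsDirectedOrder Γ) (_ : Nonempty Γ) (e : Γ → Ω →ₘ[μ] ℝ),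
    Antitone e ∧ IsGLB (Set.range e) 0 ∧
    ∀ γ, ∃ α, ∀ β, α ≤ β → vnorm (x₀ - x β) ≤ e γ

/-- A subset of `L⁰(Ω, H)` is bounded if its norms have a common upper bound in `L⁰(Ω)`. -/
def IsVBounded (S : Set B.L0) : Prop := ∃ c : Ω →ₘ[μ] ℝ, ∀ x ∈ S, vnorm x ≤ c

/-- An `L⁰`-linear operator is `L⁰`-bounded if it maps bounded sets to bounded sets. -/
def IsL0Bounded (T : Module.End (Ω →ₘ[μ] ℂ) B.L0) : Prop :=
  ∀ S : Set B.L0, IsVBounded S → IsVBounded (T '' S)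

/-- `N` is the norm `‖T‖ = sup {‖T x‖ : ‖x‖ ≤ 1}`, the supremum being taken in `L⁰(Ω)`. -/
def IsOperatorNorm (T : Module.End (Ω →ₘ[μ] ℂ) B.L0) (N : Ω →ₘ[μ] ℝ) : Prop :=
  IsLUB {r | ∃ x : B.L0, vnorm x ≤ 1 ∧ r = vnorm (T x)} N

/-- A contraction: an `L⁰`-linear `L⁰`-bounded operator with `‖T‖ ≤ 1`. -/
def IsContraction (T : Module.End (Ω →ₘ[μ] ℂ) B.L0) : Prop :=
  IsL0Bounded T ∧ ∃ N, IsOperatorNorm T N ∧ N ≤ 1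

/-- A projection: an `L⁰`-linear operator with `P² = P = P*`. -/
def IsProjection (P : Module.End (Ω →ₘ[μ] ℂ) B.L0) : Prop :=
  P * P = P ∧ ∀ x y, vinner (P x) y = vinner x (P y)

end L0

variable {B}

/-- `A_n(T, û) = n⁻¹ ∑_{k < n} T^k û`. -/
noncomputable def average (T : Module.End (Ω →ₘ[μ] ℂ) B.L0) (n : ℕ) (x : B.L0) : B.L0 :=
  (n : ℂ)⁻¹ • ∑ k ∈ Finset.range n, (T ^ k) x

/-- `A_{n₁,…,n_d}(T₁, …, T_d, û) = (n₁ ⋯ n_d)⁻¹ ∑_{i₁ < n₁} ⋯ ∑_{i_d < n_d} T₁^{i₁} ⋯ T_d^{i_d} û`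
(the product of operators is composition, so `T_d^{i_d}` is applied first). -/
noncomputable def multiAverage {d : ℕ} (T : Fin d → Module.End (Ω →ₘ[μ] ℂ) B.L0)
    (n : Fin d → ℕ) (x : B.L0) : B.L0 :=
  (∏ j, (n j : ℂ))⁻¹ • ∑ i ∈ Fintype.piFinset fun j => Finset.range (n j),
    (List.ofFn fun j => T j ^ i j).prod x

end MeasurableBundle

end HilbertKaplansky

/-! A contraction `T` satisfies `‖T x‖ ≤ ‖x‖` almost everywhere, but it need not act on individual
fibres. Along countably many orbits it nevertheless does: off a null set, shifting the orbits does
not increase the norm of any finite linear combination in `H ω` (`ae_norm_sum_shift_le`). There the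
shift extends to a contraction of `H ω`, and von Neumann's theorem gives convergence of the averages
to a self-adjoint idempotent applied to the starting vectors (`exists_projection_limit`). Since
almost everywhere limits of measurable sections are measurable, these limits define an operator `P`.
Its projection identities involve two orbits at a time, so they are checked fibrewise
(`exists_projection_aeTendsto`).

Almost everywhere convergence of a sequence becomes norm convergence through the tail suprema of the
errors. For several parameters, the outermost average is split off: if the inner averages `y` tend
to `y₀`, then `z - A y = (z - A y₀) + A (y₀ - y)`, where the second term is at most `‖y₀ - y‖` for
every outer index. The indices thus stay independent and commutation plays no role
(`DominatedTendsto.apply_cons`). -/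

namespace HilbertKaplansky

universe u v

/-! ### Mean ergodic theorem in one Hilbert space -/

/-- A linear shift `σ` that does not increase the seminorm `‖Φ ·‖` is intertwined by `Φ` with a
contraction of the whole Hilbert space. -/
theorem exists_contraction_intertwining {V E : Type*} [AddCommGroup V] [Module ℂ V]
    [NormedAddCommGroup E] [InnerProductSpace ℂ E] [CompleteSpace E]
    (Φ : V →ₗ[ℂ] E) (σ : V →ₗ[ℂ] V) (h : ∀ p, ‖Φ (σ p)‖ ≤ ‖Φ p‖) :
    ∃ F : E →L[ℂ] E, ‖F‖ ≤ 1 ∧ ∀ p, F (Φ p) = Φ (σ p) := by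
  let K : Submodule ℂ E := (LinearMap.range Φ).topologicalClosure
  have : CompleteSpace K := (LinearMap.range Φ).isClosed_topologicalClosure.completeSpace_coe
  have hmem : ∀ p, Φ p ∈ K := fun p =>
    (LinearMap.range Φ).le_topologicalClosure (LinearMap.mem_range_self Φ p)
  let e : V →ₗ[ℂ] K := Φ.codRestrict K hmem
  have hd : DenseRange e := by
    intro x
    rw [Topology.IsInducing.subtypeVal.closure_eq_preimage_closure_image]
    have : Subtype.val '' Set.range e = (LinearMap.range Φ : Set E) := by
      ext y
      simp [e]
    change (x : E) ∈ closure (Subtype.val '' Set.range e)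
    rw [this]
    exact x.2
  have hb : ∀ p, ‖(Φ ∘ₗ σ) p‖ ≤ 1 * ‖e p‖ := fun p => by simpa [e] using h p
  let G : K →L[ℂ] E := (Φ ∘ₗ σ).extendOfNorm e
  -- `G` lives only on the closed span `K`; the orthogonal projection onto `K` extends it to `E`
  -- without increasing the norm.
  refine ⟨G ∘L K.orthogonalProjectionOnto, ?_, fun p => ?_⟩
  · refine ContinuousLinearMap.opNorm_le_bound _ zero_le_one fun x => ?_
    calc ‖G (K.orthogonalProjectionOnto x)‖ ≤ 1 * ‖K.orthogonalProjectionOnto x‖ :=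
          LinearMap.norm_extendOfNorm_apply_le hd _ hb _
      _ ≤ 1 * ‖x‖ := by
          gcongr
          simpa using K.orthogonalProjectionOnto.le_of_opNorm_le K.orthogonalProjectionOnto_norm_le x
  · have : K.orthogonalProjectionOnto (Φ p) = e p :=
      K.orthogonalProjectionOnto_mem_subspace_eq_self ⟨Φ p, hmem p⟩
    rw [ContinuousLinearMap.comp_apply, this]
    exact LinearMap.extendOfNorm_eq hd ⟨1, hb⟩ p

/-- The mean ergodic theorem for a family of orbits `k ↦ u (i, k)`: if the shift is
contractive on their linear combinations, the averages converge to the values of an orthogonal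
projection. -/
theorem exists_projection_limit {κ E : Type*}
    [NormedAddCommGroup E] [InnerProductSpace ℂ E] [CompleteSpace E] (u : κ × ℕ → E)
    (h : ∀ (s : Finset (κ × ℕ)) (c : κ × ℕ → ℂ),
      ‖∑ i ∈ s, c i • u (i.1, i.2 + 1)‖ ≤ ‖∑ i ∈ s, c i • u i‖) :
    ∃ Q : E →L[ℂ] E, (∀ x y, inner ℂ (Q x) y = inner ℂ x (Q y)) ∧ (∀ x, Q (Q x) = Q x) ∧
      ∀ i, Tendsto (fun n : ℕ => (n : ℂ)⁻¹ • ∑ k ∈ Finset.range n, u (i, k)) atTop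
        (𝓝 (Q (u (i, 0)))) := by
  -- On the free space the shift is well defined even if the vectors `u i` are linearly dependent.
  let Φ : (κ × ℕ →₀ ℂ) →ₗ[ℂ] E := Finsupp.linearCombination ℂ u
  let σ : (κ × ℕ →₀ ℂ) →ₗ[ℂ] (κ × ℕ →₀ ℂ) :=
    Finsupp.linearCombination ℂ fun i => Finsupp.single (i.1, i.2 + 1) 1
  obtain ⟨F, hF, hFΦ⟩ := exists_contraction_intertwining Φ σ fun p => by
    have : Φ (σ p) = ∑ i ∈ p.support, p i • u (i.1, i.2 + 1) := by
      rw [show σ p = ∑ i ∈ p.support, p i • Finsupp.single (i.1, i.2 + 1) 1 from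
        Finsupp.linearCombination_apply _ _, map_sum]
      simp [Φ]
    rw [this]
    exact h p.support p
  have hstep : ∀ i k, F (u (i, k)) = u (i, k + 1) := fun i k => by
    simpa [Φ, σ] using hFΦ (Finsupp.single (i, k) 1)
  have hiter : ∀ i k, F^[k] (u (i, 0)) = u (i, k) := by
    intro i k
    induction k with
    | zero => rfl
    | succ k ih => rw [Function.iterate_succ_apply', ih, hstep]
  refine ⟨(F.eqLocus (1 : E →L[ℂ] E)).starProjection,
    fun x y => Submodule.inner_starProjection_left_eq_right _ x y,
    fun x => Submodule.starProjection_eq_self_iff.2 (Submodule.starProjection_apply_mem _ x),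
    fun i => ?_⟩
  have := F.tendsto_birkhoffAverage_orthogonalProjection hF (u (i, 0))
  simp only [birkhoffAverage, birkhoffSum, hiter, id] at this
  exact this

namespace MeasurableBundle

variable {Ω : Type u} [MeasurableSpace Ω] {μ : Measure Ω} {H : Ω → Type v}
variable [∀ ω, NormedAddCommGroup (H ω)] [∀ ω, InnerProductSpace ℂ (H ω)]
variable {B : MeasurableBundle μ H}

/-! ### Closure of measurable sections under limits -/

theorem IsStepSection.isMeasurableSection {s : ∀ ω, H ω} (hs : B.IsStepSection s) :
    B.IsMeasurableSection s :=
  ⟨fun _ => s, fun _ => hs, by simp⟩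

/-- Almost everywhere limits of sequences of measurable sections are measurable. -/
theorem IsMeasurableSection.of_tendsto_ae [IsFiniteMeasure μ] [μ.IsComplete]
    {w : ℕ → ∀ ω, H ω} {u : ∀ ω, H ω} (hw : ∀ n, B.IsMeasurableSection (w n))
    (h : ∀ᵐ ω ∂μ, Tendsto (fun n => w n ω) atTop (𝓝 (u ω))) : B.IsMeasurableSection u := by
  -- Diagonal choice: `s n` is within `2⁻ⁿ` of `w n` off a set of measure at most `2⁻ⁿ`, because on
  -- a finite measure space almost everywhere convergence implies convergence in measure.
  -- Borel–Cantelli then gives `s n - w n → 0` almost everywhere.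
  have key : ∀ n : ℕ, ∃ s, B.IsStepSection s ∧
      μ {ω | ENNReal.ofReal ((1 / 2) ^ n) ≤ edist ‖s ω - w n ω‖ 0} ≤ (1 / 2) ^ n := by
    intro n
    obtain ⟨s, hs, hsw⟩ := hw n
    have hm : ∀ k, AEStronglyMeasurable (fun ω => ‖s k ω - w n ω‖) μ := fun k =>
      IsMeasurableSection.aestronglyMeasurable_norm (B := B)
        (B.measurableSections.sub_mem (hs k).isMeasurableSection (hw n))
    have ht := tendstoInMeasure_of_tendsto_ae hm (g := fun _ => (0 : ℝ)) hsw
    have := ht (ENNReal.ofReal ((1 / 2) ^ n)) (by positivity)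
    have hpos : (0 : ENNReal) < (1 / 2) ^ n := ENNReal.pow_pos (by simp) n
    obtain ⟨k, hk⟩ := (this.eventually (Iic_mem_nhds hpos)).exists
    exact ⟨s k, hs k, hk⟩
  choose s hs hsμ using key
  refine ⟨s, hs, ?_⟩
  have hsum : ∑' n, μ {ω | ENNReal.ofReal ((1 / 2) ^ n) ≤ edist ‖s n ω - w n ω‖ 0} ≠ ⊤ := by
    refine ne_top_of_le_ne_top ?_ (ENNReal.tsum_le_tsum hsμ)
    rw [ENNReal.tsum_geometric]
    simp
  filter_upwards [ae_eventually_notMem hsum, h] with ω hω hlim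
  have h0 : Tendsto (fun n => s n ω - w n ω) atTop (𝓝 0) := by
    refine squeeze_zero_norm' (a := fun n : ℕ => ((1 : ℝ) / 2) ^ n) ?_
      (tendsto_pow_atTop_nhds_zero_of_lt_one (by norm_num) (by norm_num))
    filter_upwards [hω] with n hn
    simp only [not_le, edist_dist, dist_zero_right, norm_norm] at hn
    exact ((ENNReal.ofReal_lt_ofReal_iff (by positivity)).1 hn).le
  rw [← tendsto_iff_norm_sub_tendsto_zero]
  simpa using h0.add hlim

namespace L0

/-! ### Pointwise calculus with representatives -/

/-- A representative of a class of measurable sections. -/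
noncomputable def rep (x : B.L0) : ∀ ω, H ω := (mk_surjective x).choose.1

theorem isMeasurableSection_rep (x : B.L0) : B.IsMeasurableSection (rep x) :=
  (mk_surjective x).choose.2

theorem mk_rep (x : B.L0) : mk ⟨rep x, isMeasurableSection_rep x⟩ = x :=
  (mk_surjective x).choose_spec

theorem rep_mk (u : B.measurableSections) : ∀ᵐ ω ∂μ, rep (mk u) ω = u.1 ω :=
  mk_eq_mk.1 (mk_rep (mk u))

theorem ext_rep {x y : B.L0} (h : ∀ᵐ ω ∂μ, rep x ω = rep y ω) : x = y := by
  rw [← mk_rep x, ← mk_rep y]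
  exact mk_eq_mk.2 h

theorem rep_add (x y : B.L0) : ∀ᵐ ω ∂μ, rep (x + y) ω = rep x ω + rep y ω := by
  have := rep_mk (⟨rep x, isMeasurableSection_rep x⟩ + ⟨rep y, isMeasurableSection_rep y⟩ :
    B.measurableSections)
  rwa [← mk_add, mk_rep, mk_rep] at this

theorem rep_smul (f : Ω →ₘ[μ] ℂ) (x : B.L0) : ∀ᵐ ω ∂μ, rep (f • x) ω = f ω • rep x ω := by
  have := rep_mk (smulAux f ⟨rep x, isMeasurableSection_rep x⟩)
  rwa [← smul_mk, mk_rep] at this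

theorem rep_complex_smul (a : ℂ) (x : B.L0) : ∀ᵐ ω ∂μ, rep (a • x) ω = a • rep x ω := by
  have := rep_mk (a • ⟨rep x, isMeasurableSection_rep x⟩ : B.measurableSections)
  have h : mk (a • ⟨rep x, isMeasurableSection_rep x⟩ : B.measurableSections) =
    a • mk (⟨rep x, isMeasurableSection_rep x⟩ : B.measurableSections) := rfl
  rwa [h, mk_rep] at this

theorem rep_zero : ∀ᵐ ω ∂μ, rep (0 : B.L0) ω = 0 :=
  rep_mk (0 : B.measurableSections)

theorem rep_sub (x y : B.L0) : ∀ᵐ ω ∂μ, rep (x - y) ω = rep x ω - rep y ω := by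
  filter_upwards [rep_add (x - y) y] with ω h
  rw [sub_add_cancel] at h
  rw [h, add_sub_cancel_right]

theorem rep_sum {ι : Type*} (s : Finset ι) (x : ι → B.L0) :
    ∀ᵐ ω ∂μ, rep (∑ i ∈ s, x i) ω = ∑ i ∈ s, rep (x i) ω := by
  classical
  induction s using Finset.induction_on with
  | empty => simpa using rep_zero
  | insert i s hi ih =>
    rw [Finset.sum_insert hi]
    filter_upwards [ih, rep_add (x i) (∑ i ∈ s, x i)] with ω h₁ h₂
    rw [Finset.sum_insert hi, h₂, h₁]

/-- Lets `L⁰`-linear operators be treated as complex linear. -/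
theorem complex_smul_eq_const_smul (a : ℂ) (x : B.L0) :
    a • x = (AEEqFun.const Ω a : Ω →ₘ[μ] ℂ) • x := by
  refine ext_rep ?_
  filter_upwards [rep_complex_smul a x, rep_smul (AEEqFun.const Ω a) x,
    AEEqFun.coeFn_const (μ := μ) Ω a] with ω h₁ h₂ h₃
  rw [h₁, h₂, h₃, Function.const_apply]

section Norm

variable [μ.IsComplete]

theorem coeFn_vnorm (x : B.L0) : ∀ᵐ ω ∂μ, vnorm x ω = ‖rep x ω‖ := by
  conv => enter [1, ω]; rw [← mk_rep x]
  rw [vnorm_mk]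
  filter_upwards [AEEqFun.coeFn_mk (fun ω => ‖rep x ω‖)
    (isMeasurableSection_rep x).aestronglyMeasurable_norm, rep_mk ⟨rep x, isMeasurableSection_rep x⟩]
    with ω h h'
  rw [h, h']

theorem coeFn_vinner (x y : B.L0) : ∀ᵐ ω ∂μ, vinner x y ω = inner ℂ (rep y ω) (rep x ω) := by
  have := AEEqFun.coeFn_mk (fun ω => inner ℂ (rep y ω) (rep x ω))
    ((isMeasurableSection_rep y).aestronglyMeasurable_inner (isMeasurableSection_rep x))
  have h := vinner_mk ⟨rep x, isMeasurableSection_rep x⟩ ⟨rep y, isMeasurableSection_rep y⟩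
  rw [mk_rep, mk_rep] at h
  rw [h]
  exact this

theorem vnorm_le_vnorm_iff {x y : B.L0} :
    vnorm x ≤ vnorm y ↔ ∀ᵐ ω ∂μ, ‖rep x ω‖ ≤ ‖rep y ω‖ := by
  rw [← AEEqFun.coeFn_le]
  refine eventually_congr ?_
  filter_upwards [coeFn_vnorm x, coeFn_vnorm y] with ω h₁ h₂
  rw [h₁, h₂]

/-- Normalize: `x / (‖x‖ + ε)` lies in the unit ball, and `L⁰`-linearity pulls the scalar factor out
of `T`. Taking `ε = 1 / (n + 1)` avoids dividing by zero where `x` vanishes; then `n → ∞`. -/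
theorem IsContraction.vnorm_apply_le {T : Module.End (Ω →ₘ[μ] ℂ) B.L0} (hT : IsContraction T)
    (x : B.L0) : vnorm (T x) ≤ vnorm x := by
  obtain ⟨-, N, hN, hN1⟩ := hT
  rw [vnorm_le_vnorm_iff]
  have key : ∀ n : ℕ, ∀ᵐ ω ∂μ, ‖rep (T x) ω‖ ≤ ‖rep x ω‖ + 1 / ((n : ℝ) + 1) := by
    intro n
    have hn : (0 : ℝ) < 1 / ((n : ℝ) + 1) := by positivity
    have hm : AEStronglyMeasurable
        (fun ω => (((‖rep x ω‖ + 1 / ((n : ℝ) + 1))⁻¹ : ℝ) : ℂ)) μ := by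
      refine Complex.continuous_ofReal.comp_aestronglyMeasurable ?_
      exact ((isMeasurableSection_rep x).aestronglyMeasurable_norm.aemeasurable.add_const
        _).inv.aestronglyMeasurable
    let g : Ω →ₘ[μ] ℂ := AEEqFun.mk _ hm
    have hg : ∀ᵐ ω ∂μ, ‖g ω‖ = (‖rep x ω‖ + 1 / ((n : ℝ) + 1))⁻¹ := by
      filter_upwards [AEEqFun.coeFn_mk _ hm] with ω h
      rw [h, Complex.norm_real, Real.norm_of_nonneg (by positivity)]
    have h1 : vnorm (g • x) ≤ 1 := by
      rw [← AEEqFun.coeFn_le]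
      filter_upwards [coeFn_vnorm (g • x), rep_smul g x, hg,
        AEEqFun.coeFn_one (α := Ω) (β := ℝ) (μ := μ)] with ω h₁ h₂ h₃ h₄
      rw [h₁, h₂, norm_smul, h₃, h₄, Pi.one_apply, inv_mul_le_one₀ (by positivity)]
      linarith
    have h2 : vnorm (T (g • x)) ≤ 1 := (hN.1 ⟨_, h1, rfl⟩).trans hN1
    rw [map_smul, ← AEEqFun.coeFn_le] at h2
    filter_upwards [h2, coeFn_vnorm (g • T x), rep_smul g (T x), hg,
      AEEqFun.coeFn_one (α := Ω) (β := ℝ) (μ := μ)] with ω h₀ h₁ h₂ h₃ h₄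
    rwa [h₁, h₂, norm_smul, h₃, h₄, Pi.one_apply, inv_mul_le_one₀ (by positivity)] at h₀
  filter_upwards [ae_all_iff.2 key] with ω hω
  exact ge_of_tendsto' (by simpa using
    (tendsto_one_div_add_atTop_nhds_zero_nat (𝕜 := ℝ)).const_add ‖rep x ω‖) hω

end Norm

end L0

/-! ### Averaging operators and the recursion in the number of parameters -/

/-- The averaging operator `x ↦ A_n(T, x)`. -/
noncomputable def averageOp (T : Module.End (Ω →ₘ[μ] ℂ) B.L0) (n : ℕ) :
    Module.End (Ω →ₘ[μ] ℂ) B.L0 :=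
  (AEEqFun.const Ω (n : ℂ)⁻¹ : Ω →ₘ[μ] ℂ) • ∑ k ∈ Finset.range n, T ^ k

theorem average_eq_averageOp (T : Module.End (Ω →ₘ[μ] ℂ) B.L0) (n : ℕ) (x : B.L0) :
    average T n x = averageOp T n x := by
  simp [average, averageOp, L0.complex_smul_eq_const_smul, LinearMap.sum_apply]

theorem rep_averageOp (T : Module.End (Ω →ₘ[μ] ℂ) B.L0) (n : ℕ) (x : B.L0) :
    ∀ᵐ ω ∂μ, L0.rep (averageOp T n x) ω =
      (n : ℂ)⁻¹ • ∑ k ∈ Finset.range n, L0.rep ((T ^ k) x) ω := by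
  rw [← average_eq_averageOp, average]
  filter_upwards [L0.rep_complex_smul (n : ℂ)⁻¹ (∑ k ∈ Finset.range n, (T ^ k) x),
    L0.rep_sum (Finset.range n) fun k => (T ^ k) x] with ω h₁ h₂
  rw [h₁, h₂]

theorem map_complex_smul (T : Module.End (Ω →ₘ[μ] ℂ) B.L0) (a : ℂ) (x : B.L0) :
    T (a • x) = a • T x := by
  simp only [L0.complex_smul_eq_const_smul, map_smul]

theorem multiAverage_zero (T : Fin 0 → Module.End (Ω →ₘ[μ] ℂ) B.L0) (n : Fin 0 → ℕ) (x : B.L0) :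
    multiAverage T n x = x := by
  simp [multiAverage]

/-- `T 0` is applied last, so its sum and scalar factor come out in front; the multi-indices split
along `Fin.consEquiv`. -/
theorem multiAverage_succ {d : ℕ} (T : Fin (d + 1) → Module.End (Ω →ₘ[μ] ℂ) B.L0)
    (n : Fin (d + 1) → ℕ) (x : B.L0) :
    multiAverage T n x =
      averageOp (T 0) (n 0) (multiAverage (fun j => T j.succ) (fun j => n j.succ) x) := by
  rw [← average_eq_averageOp, average]
  simp only [multiAverage, map_complex_smul, map_sum, ← Finset.smul_sum]
  rw [smul_smul, Fin.prod_univ_succ, mul_inv, ← Finset.sum_product']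
  congr 1
  symm
  refine Finset.sum_equiv (Fin.consEquiv fun _ => ℕ) ?_ ?_
  · rintro ⟨k, i⟩
    simp [Fintype.mem_piFinset, Fin.forall_fin_succ, Fin.consEquiv]
  · rintro ⟨k, i⟩ -
    simp [List.ofFn_succ, Fin.consEquiv]

namespace L0

/-! ### Almost everywhere convergence and the one-parameter projection -/

/-- Almost everywhere convergence of a sequence of classes of sections. -/
def AETendsto (x : ℕ → B.L0) (y : B.L0) : Prop :=
  ∀ᵐ ω ∂μ, Tendsto (fun n => rep (x n) ω) atTop (𝓝 (rep y ω))

theorem AETendsto.unique {x : ℕ → B.L0} {y z : B.L0} (hy : AETendsto x y) (hz : AETendsto x z) :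
    y = z := by
  refine ext_rep ?_
  filter_upwards [hy, hz] with ω h₁ h₂ using tendsto_nhds_unique h₁ h₂

theorem AETendsto.add {x y : ℕ → B.L0} {a b : B.L0} (hx : AETendsto x a) (hy : AETendsto y b) :
    AETendsto (fun n => x n + y n) (a + b) := by
  filter_upwards [hx, hy, rep_add a b, ae_all_iff.2 fun n => rep_add (x n) (y n)]
    with ω h₁ h₂ h₃ h₄
  simp only [h₃, h₄]
  exact h₁.add h₂

theorem AETendsto.smul {x : ℕ → B.L0} {a : B.L0} (f : Ω →ₘ[μ] ℂ) (hx : AETendsto x a) :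
    AETendsto (fun n => f • x n) (f • a) := by
  filter_upwards [hx, rep_smul f a, ae_all_iff.2 fun n => rep_smul f (x n)] with ω h₁ h₂ h₃
  simp only [h₂, h₃]
  exact h₁.const_smul (f ω)

theorem exists_aeTendsto [IsFiniteMeasure μ] [μ.IsComplete] {x : ℕ → B.L0}
    (h : ∀ᵐ ω ∂μ, ∃ y, Tendsto (fun n => rep (x n) ω) atTop (𝓝 y)) : ∃ y, AETendsto x y := by
  classical
  let u : ∀ ω, H ω := fun ω =>
    if h : ∃ y, Tendsto (fun n => rep (x n) ω) atTop (𝓝 y) then h.choose else 0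
  have hu : ∀ᵐ ω ∂μ, Tendsto (fun n => rep (x n) ω) atTop (𝓝 (u ω)) := by
    filter_upwards [h] with ω hω
    simp only [u, dif_pos hω]
    exact hω.choose_spec
  have hm : B.IsMeasurableSection u :=
    .of_tendsto_ae (fun n => isMeasurableSection_rep (x n)) hu
  refine ⟨mk ⟨u, hm⟩, ?_⟩
  filter_upwards [hu, rep_mk ⟨u, hm⟩] with ω h₁ h₂
  rwa [h₂]

variable [μ.IsComplete]

section Orbits

variable {T : Module.End (Ω →ₘ[μ] ℂ) B.L0}

theorem ae_norm_sum_shift_le (hT : ∀ x, vnorm (T x) ≤ vnorm x) {κ : Type*} [Countable κ]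
    (x : κ → B.L0) : ∀ᵐ ω ∂μ, ∀ (s : Finset (κ × ℕ)) (c : κ × ℕ → ℂ),
      ‖∑ i ∈ s, c i • rep ((T ^ (i.2 + 1)) (x i.1)) ω‖ ≤
        ‖∑ i ∈ s, c i • rep ((T ^ i.2) (x i.1)) ω‖ := by
  -- There are uncountably many coefficient families, so only a countable dense set is used to form
  -- the null set; continuity in `c` recovers the rest.
  obtain ⟨D, hDc, hD⟩ := TopologicalSpace.exists_countable_dense (κ × ℕ → ℂ)
  have key : ∀ (s : Finset (κ × ℕ)), ∀ c ∈ D, ∀ᵐ ω ∂μ,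
      ‖∑ i ∈ s, c i • rep ((T ^ (i.2 + 1)) (x i.1)) ω‖ ≤
        ‖∑ i ∈ s, c i • rep ((T ^ i.2) (x i.1)) ω‖ := by
    intro s c _
    have hrep : ∀ y : κ × ℕ → B.L0, ∀ᵐ ω ∂μ,
        rep (∑ i ∈ s, c i • y i) ω = ∑ i ∈ s, c i • rep (y i) ω := by
      intro y
      filter_upwards [rep_sum s fun i => c i • y i,
        ae_all_iff.2 fun i => rep_complex_smul (c i) (y i)] with ω h₁ h₂
      simp only [h₁, h₂]
    have h := hT (∑ i ∈ s, c i • (T ^ i.2) (x i.1))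
    simp only [map_sum, map_complex_smul, ← Module.End.mul_apply, ← pow_succ'] at h
    rw [vnorm_le_vnorm_iff] at h
    filter_upwards [h, hrep fun i => (T ^ (i.2 + 1)) (x i.1), hrep fun i => (T ^ i.2) (x i.1)]
      with ω h₀ h₁ h₂
    rwa [h₁, h₂] at h₀
  have hall := ae_all_iff.2 fun s => (ae_ball_iff hDc).2 (key s)
  filter_upwards [hall] with ω hω s c
  have hcl : IsClosed {c : κ × ℕ → ℂ | ‖∑ i ∈ s, c i • rep ((T ^ (i.2 + 1)) (x i.1)) ω‖ ≤
      ‖∑ i ∈ s, c i • rep ((T ^ i.2) (x i.1)) ω‖} :=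
    isClosed_le (by fun_prop) (by fun_prop)
  exact closure_minimal (fun c hc => hω s c hc) hcl (hD c)

/-- The fibrewise mean ergodic theorem along countably many orbits. -/
theorem ae_exists_projection_limit [∀ ω, CompleteSpace (H ω)]
    (hT : ∀ x, vnorm (T x) ≤ vnorm x) {κ : Type*} [Countable κ] (x : κ → B.L0) :
    ∀ᵐ ω ∂μ, ∃ Q : H ω →L[ℂ] H ω,
      (∀ y z, inner ℂ (Q y) z = inner ℂ y (Q z)) ∧ (∀ y, Q (Q y) = Q y) ∧
      ∀ i, Tendsto (fun n => rep (averageOp T n (x i)) ω) atTop (𝓝 (Q (rep (x i) ω))) := by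
  filter_upwards [ae_norm_sum_shift_le hT x,
    ae_all_iff.2 fun n => ae_all_iff.2 fun i => rep_averageOp T n (x i)] with ω h₁ h₂
  obtain ⟨Q, hQ, hQQ, hlim⟩ :=
    exists_projection_limit (fun i : κ × ℕ => rep ((T ^ i.2) (x i.1)) ω) h₁
  refine ⟨Q, hQ, hQQ, fun i => ?_⟩
  simp only [h₂]
  exact hlim i

/-- The limit of the averages of a norm-decreasing operator exists and is a projection. -/
theorem exists_projection_aeTendsto [IsFiniteMeasure μ] [∀ ω, CompleteSpace (H ω)]
    (hT : ∀ x, vnorm (T x) ≤ vnorm x) : ∃ P : Module.End (Ω →ₘ[μ] ℂ) B.L0,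
      IsProjection P ∧ ∀ x, AETendsto (fun n => averageOp T n x) (P x) := by
  have hex : ∀ x, ∃ y, AETendsto (fun n => averageOp T n x) y := by
    intro x
    refine exists_aeTendsto ?_
    filter_upwards [ae_exists_projection_limit hT fun _ : Unit => x] with ω ⟨Q, _, _, h⟩
    exact ⟨_, h ()⟩
  choose p hp using hex
  let P : Module.End (Ω →ₘ[μ] ℂ) B.L0 :=
    { toFun := p
      map_add' := fun x y => (hp (x + y)).unique <| by
        simpa only [map_add] using (hp x).add (hp y)
      map_smul' := fun f x => (hp (f • x)).unique <| by
        simpa only [map_smul, RingHom.id_apply] using (hp x).smul f }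
  -- Both orbits are treated together so that a single `Q` serves `x` and `y`. The pair `x`, `p x`
  -- yields idempotence, a general pair self-adjointness.
  have hfib : ∀ x y, ∀ᵐ ω ∂μ, ∃ Q : H ω →L[ℂ] H ω,
      (∀ y z, inner ℂ (Q y) z = inner ℂ y (Q z)) ∧ (∀ y, Q (Q y) = Q y) ∧
      rep (p x) ω = Q (rep x ω) ∧ rep (p y) ω = Q (rep y ω) := by
    intro x y
    filter_upwards [ae_exists_projection_limit hT fun b : Bool => cond b x y, hp x, hp y]
      with ω ⟨Q, h₁, h₂, h₃⟩ hx hy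
    exact ⟨Q, h₁, h₂, tendsto_nhds_unique hx (h₃ true), tendsto_nhds_unique hy (h₃ false)⟩
  refine ⟨P, ⟨LinearMap.ext fun x => ext_rep ?_, fun x y => AEEqFun.ext ?_⟩, hp⟩
  · change ∀ᵐ ω ∂μ, rep (p (p x)) ω = rep (p x) ω
    filter_upwards [hfib x (p x)] with ω ⟨Q, _, h₁, h₂, h₃⟩
    rw [h₃, h₂, h₁]
  · change ∀ᵐ ω ∂μ, vinner (p x) y ω = vinner x (p y) ω
    filter_upwards [hfib x y, coeFn_vinner (p x) y, coeFn_vinner x (p y)]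
      with ω ⟨Q, h₁, _, h₂, h₃⟩ h₄ h₅
    rw [h₄, h₅, h₂, h₃, h₁]

theorem vnorm_pow_apply_le (hT : ∀ x, vnorm (T x) ≤ vnorm x) (k : ℕ) (x : B.L0) :
    vnorm ((T ^ k) x) ≤ vnorm x := by
  induction k with
  | zero => exact le_rfl
  | succ k ih =>
    rw [pow_succ', Module.End.mul_apply]
    exact (hT _).trans ih

theorem vnorm_averageOp_le (hT : ∀ x, vnorm (T x) ≤ vnorm x) (n : ℕ) (x : B.L0) :
    vnorm (averageOp T n x) ≤ vnorm x := by
  rw [vnorm_le_vnorm_iff]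
  filter_upwards [rep_averageOp T n x,
    ae_all_iff.2 fun k => vnorm_le_vnorm_iff.1 (vnorm_pow_apply_le hT k x)] with ω h₁ h₂
  rw [h₁, norm_smul, norm_inv, Complex.norm_natCast]
  calc (n : ℝ)⁻¹ * ‖∑ k ∈ Finset.range n, rep ((T ^ k) x) ω‖
      ≤ (n : ℝ)⁻¹ * (n * ‖rep x ω‖) := by
        gcongr
        simpa using norm_sum_le_of_le (Finset.range n) fun k _ => h₂ k
    _ = (n : ℝ)⁻¹ * n * ‖rep x ω‖ := by ring
    _ ≤ 1 * ‖rep x ω‖ := by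
        gcongr
        -- Only an inequality: for `n = 0` the product is `0`.
        exact inv_mul_le_one
    _ = ‖rep x ω‖ := one_mul _

end Orbits

/-! ### Dominated convergence and independent indices -/

/-- Norm convergence of a net dominated by a sequence that decreases to `0` almost everywhere. -/
def DominatedTendsto {ι : Type*} [Preorder ι] (x : ι → B.L0) (x₀ : B.L0) : Prop :=
  ∃ e : ℕ → Ω →ₘ[μ] ℝ, Antitone e ∧ (∀ᵐ ω ∂μ, Tendsto (fun m => e m ω) atTop (𝓝 0)) ∧
    ∀ m, ∃ α, ∀ β, α ≤ β → vnorm (x₀ - x β) ≤ e m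

theorem DominatedTendsto.boTendsto {ι : Type*} [Preorder ι] {x : ι → B.L0} {x₀ : B.L0}
    (h : DominatedTendsto x x₀) : BoTendsto x x₀ := by
  obtain ⟨e, he, hlim, hdom⟩ := h
  -- The index set of the dominating net must lie in the universe of `Ω`, hence `ULift`.
  refine ⟨ULift ℕ, inferInstance, inferInstance, inferInstance, fun m => e m.down,
    fun a b hab => he hab, ⟨?_, ?_⟩, fun m => hdom m.down⟩
  · rintro _ ⟨m, rfl⟩
    obtain ⟨α, hα⟩ := hdom m.down
    refine le_trans ?_ (hα α le_rfl)
    rw [← AEEqFun.coeFn_le]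
    filter_upwards [coeFn_vnorm (x₀ - x α), AEEqFun.coeFn_zero (α := Ω) (β := ℝ) (μ := μ)]
      with ω h₁ h₂
    rw [h₁, h₂]
    exact norm_nonneg _
  · intro b hb
    have hb' : ∀ m, ∀ᵐ ω ∂μ, b ω ≤ e m ω := fun m => AEEqFun.coeFn_le.2 (hb ⟨⟨m⟩, rfl⟩)
    rw [← AEEqFun.coeFn_le]
    filter_upwards [hlim, ae_all_iff.2 hb', AEEqFun.coeFn_zero (α := Ω) (β := ℝ) (μ := μ)]
      with ω h₁ h₂ h₃
    rw [h₃]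
    exact ge_of_tendsto' h₁ h₂

/-- The tail suprema `⨆ k, ‖x₀ - x (m + k)‖` decrease in `m` and tend to `0` wherever the errors do.
-/
theorem AETendsto.dominatedTendsto {x : ℕ → B.L0} {x₀ : B.L0} (h : AETendsto x x₀) :
    DominatedTendsto x x₀ := by
  let a : ℕ → Ω → ℝ := fun k ω => ‖rep (x₀ - x k) ω‖
  have hm : ∀ m, AEStronglyMeasurable (fun ω => ⨆ k, a (m + k) ω) μ := fun m =>
    (AEMeasurable.iSup fun k =>
      (isMeasurableSection_rep (x₀ - x (m + k))).aestronglyMeasurable_norm.aemeasurable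
      ).aestronglyMeasurable
  have ha : ∀ᵐ ω ∂μ, Tendsto (fun k => a k ω) atTop (𝓝 0) := by
    filter_upwards [h, ae_all_iff.2 fun k => rep_sub x₀ (x k)] with ω h₁ h₂
    simpa [a, h₂] using (h₁.const_sub (rep x₀ ω)).norm
  -- An unbounded real supremum has the default value `0` and would dominate nothing; convergence
  -- rules this out almost everywhere.
  have hbdd : ∀ᵐ ω ∂μ, ∀ m, BddAbove (Set.range fun k => a (m + k) ω) := by
    filter_upwards [ha] with ω hω m
    refine hω.bddAbove_range.mono ?_
    rintro _ ⟨k, rfl⟩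
    exact ⟨m + k, rfl⟩
  refine ⟨fun m => AEEqFun.mk _ (hm m), fun m m' hmm' => ?_, ?_, fun m => ⟨m, fun β hβ => ?_⟩⟩
  · refine (AEEqFun.mk_le_mk _ _).2 ?_
    filter_upwards [hbdd] with ω hω
    refine ciSup_le fun k => ?_
    obtain ⟨l, rfl⟩ := Nat.exists_eq_add_of_le hmm'
    rw [add_assoc]
    exact le_ciSup (hω m) (l + k)
  · filter_upwards [ha, ae_all_iff.2 fun m => AEEqFun.coeFn_mk _ (hm m)] with ω h₁ h₂
    simp only [h₂]
    rw [Metric.tendsto_atTop] at h₁ ⊢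
    intro ε hε
    obtain ⟨N, hN⟩ := h₁ (ε / 2) (half_pos hε)
    refine ⟨N, fun m hm => ?_⟩
    have h0 : 0 ≤ ⨆ k, a (m + k) ω := Real.iSup_nonneg fun k => norm_nonneg _
    have h1 : ⨆ k, a (m + k) ω ≤ ε / 2 := by
      refine ciSup_le fun k => ?_
      have := hN (m + k) (by omega)
      rw [Real.dist_eq, sub_zero] at this
      exact (le_abs_self _).trans this.le
    rw [Real.dist_eq, sub_zero, abs_of_nonneg h0]
    linarith
  · rw [← AEEqFun.coeFn_le]
    filter_upwards [hbdd, AEEqFun.coeFn_mk _ (hm m), coeFn_vnorm (x₀ - x β)] with ω h₁ h₂ h₃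
    rw [h₂, h₃]
    obtain ⟨l, rfl⟩ := Nat.exists_eq_add_of_le hβ
    exact le_ciSup (h₁ m) l

theorem dominatedTendsto_const {ι : Type*} [Preorder ι] [Nonempty ι] (x : B.L0) :
    DominatedTendsto (fun _ : ι => x) x := by
  refine ⟨fun _ => 0, antitone_const, ?_, fun m => ⟨Classical.arbitrary ι, fun _ _ => ?_⟩⟩
  · filter_upwards [AEEqFun.coeFn_zero (α := Ω) (β := ℝ) (μ := μ)] with ω h
    simp [h]
  · rw [← AEEqFun.coeFn_le]
    filter_upwards [coeFn_vnorm (x - x), rep_zero (B := B),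
      AEEqFun.coeFn_zero (α := Ω) (β := ℝ) (μ := μ)] with ω h₁ h₂ h₃
    rw [h₁, sub_self, h₂, h₃, norm_zero, Pi.zero_apply]

/-- Norm-decreasing operators that converge at the limit of a convergent net can be applied to
this net, with an independent index. -/
theorem DominatedTendsto.apply_cons {d : ℕ} {A : ℕ → Module.End (Ω →ₘ[μ] ℂ) B.L0}
    (hA : ∀ n x, vnorm (A n x) ≤ vnorm x) {y : (Fin d → ℕ) → B.L0} {y₀ z : B.L0}
    (hy : DominatedTendsto y y₀) (hz : DominatedTendsto (fun n => A n y₀) z) :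
    DominatedTendsto (fun n : Fin (d + 1) → ℕ => A (n 0) (y fun j => n j.succ)) z := by
  obtain ⟨e, he, helim, hedom⟩ := hy
  obtain ⟨f, hf, hflim, hfdom⟩ := hz
  refine ⟨fun m => e m + f m, fun m m' hmm' => ?_, ?_, fun m => ?_⟩
  · rw [← AEEqFun.coeFn_le]
    filter_upwards [AEEqFun.coeFn_le.2 (he hmm'), AEEqFun.coeFn_le.2 (hf hmm'),
      AEEqFun.coeFn_add (e m) (f m), AEEqFun.coeFn_add (e m') (f m')] with ω h₁ h₂ h₃ h₄
    rw [h₃, h₄]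
    exact add_le_add h₁ h₂
  · filter_upwards [helim, hflim, ae_all_iff.2 fun m => AEEqFun.coeFn_add (e m) (f m)]
      with ω h₁ h₂ h₃
    simpa [h₃] using h₁.add h₂
  · obtain ⟨α, hα⟩ := hedom m
    obtain ⟨k, hk⟩ := hfdom m
    -- The threshold `k` for the outer index depends only on the fixed vector `y₀`, not on the inner
    -- indices.
    refine ⟨Fin.cons k α, fun n hn => ?_⟩
    have hn0 : k ≤ n 0 := hn 0
    have hns : α ≤ fun j => n j.succ := fun j => by simpa using hn j.succ
    have h₁ : vnorm (A (n 0) (y₀ - y fun j => n j.succ)) ≤ e m := (hA _ _).trans (hα _ hns)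
    have h₂ := hk _ hn0
    have hsplit : z - A (n 0) (y fun j => n j.succ) =
        (z - A (n 0) y₀) + A (n 0) (y₀ - y fun j => n j.succ) := by
      rw [map_sub]
      abel
    rw [hsplit, ← AEEqFun.coeFn_le]
    filter_upwards [AEEqFun.coeFn_le.2 h₁, AEEqFun.coeFn_le.2 h₂, AEEqFun.coeFn_add (e m) (f m),
      rep_add (z - A (n 0) y₀) (A (n 0) (y₀ - y fun j => n j.succ)),
      coeFn_vnorm (z - A (n 0) y₀ + A (n 0) (y₀ - y fun j => n j.succ)),
      coeFn_vnorm (z - A (n 0) y₀), coeFn_vnorm (A (n 0) (y₀ - y fun j => n j.succ))]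
      with ω k₁ k₂ k₃ k₄ k₅ k₆ k₇
    rw [k₅, k₄, k₃, Pi.add_apply]
    rw [k₇] at k₁
    rw [k₆] at k₂
    linarith [norm_add_le (rep (z - A (n 0) y₀) ω) (rep (A (n 0) (y₀ - y fun j => n j.succ)) ω)]

theorem dominatedTendsto_multiAverage {d : ℕ} {T P : Fin d → Module.End (Ω →ₘ[μ] ℂ) B.L0}
    (hT : ∀ j x, vnorm (T j x) ≤ vnorm x)
    (hP : ∀ j x, DominatedTendsto (fun n => averageOp (T j) n x) (P j x)) (x : B.L0) :
    DominatedTendsto (fun n : Fin d → ℕ => multiAverage T n x) ((List.ofFn P).prod x) := by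
  induction d with
  | zero =>
    simp only [multiAverage_zero, List.ofFn_zero, List.prod_nil, Module.End.one_apply]
    exact dominatedTendsto_const x
  | succ d ih =>
    simp only [multiAverage_succ, List.ofFn_succ, List.prod_cons, Module.End.mul_apply]
    -- The outer averages are needed only at the limit of the inner ones, where `hP 0` applies.
    exact (ih (fun j => hT j.succ) fun j => hP j.succ).apply_cons
      (vnorm_averageOp_le (hT 0)) (hP 0 _)

end L0

end MeasurableBundle

end HilbertKaplansky

open HilbertKaplansky MeasurableBundle in
theorem theorem3p4 {Ω : Type*} [MeasurableSpace Ω] (μ : MeasureTheory.Measure Ω)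
    [MeasureTheory.IsFiniteMeasure μ] [μ.IsComplete]
    (H : Ω → Type*) [∀ ω, NormedAddCommGroup (H ω)] [∀ ω, InnerProductSpace ℂ (H ω)]
    [∀ ω, CompleteSpace (H ω)]
    (B : MeasurableBundle μ H) {d : ℕ}
    (T : Fin d → Module.End (Ω →ₘ[μ] ℂ) B.L0) (hT : ∀ j, L0.IsContraction (T j)) :
    ∃ P : Fin d → Module.End (Ω →ₘ[μ] ℂ) B.L0,
      (∀ j, L0.IsProjection (P j)) ∧
      (∀ j (x : B.L0), L0.BoTendsto (fun n : ℕ => average (T j) n x) (P j x)) ∧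
      ∀ x : B.L0, L0.BoTendsto (fun n : Fin d → ℕ => multiAverage T n x)
        ((List.ofFn P).prod x) := by
  have hT' : ∀ j x, L0.vnorm (T j x) ≤ L0.vnorm x := fun j => (hT j).vnorm_apply_le
  choose P hP hlim using fun j => L0.exists_projection_aeTendsto (hT' j)
  refine ⟨P, hP, fun j x => ?_, fun x => ?_⟩
  · simp only [average_eq_averageOp]
    exact (hlim j x).dominatedTendsto.boTendsto
  · exact (L0.dominatedTendsto_multiAverage hT'
      (fun j x => (hlim j x).dominatedTendsto) x).boTendsto
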